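/- **Setting.** A shortest-path problem consists of a finite directed graph $\mathcal G=(\mathcal V,\mathcal E)$, a lazy estimate $\hat w:\mathcal E\to\mathbb R_{>0}$, a true cost $w$ with $w(e)=\hat w(e)$ if $e$ is not in collision and $w(e)=\infty$ if $e$ is in collision, and vertices $v_{\rm source},v_{\rm target}$. Assume that no two distinct simple paths starting at $v_{\rm source}$ have the same lazy cost $\hat w(P)=\sum_{e\in P}\hat w(e)$. **The algorithm.** LRA* with lookahead $\alpha$ and greediness $\beta$ ($\alpha,\beta\in\{1,2,\dots\}\cup\{\infty\}$) maintains a search tree $\mathcal T$ rooted at $v_{\rm source}$, with at most one node $\tau$ per vertex $u[\tau]$. A node stores its parent, the true cost $c[\tau]$ of the evaluated initial portion (head) of its tree path $P[\tau]$, the lazy cost $\ell[\tau]$ of the remaining, not yet evaluated portion $P[\tau]_{\rm tail}$, and its budget $b[\tau]$, the number of edges of $P[\tau]_{\rm tail}$. The key of $\tau$ is $c[\tau]+\ell[\tau]$. Initially $\mathcal T$ consists of the root with $c=\ell=b=0$. * *Extending.* As long as some node $\tau$ with $u[\tau]=p\neq v_{\rm target}$ and $b[\tau]<\alpha$ and some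 edge $(p,v)$ of the current graph are such that $v$ has no node, or a node of key larger than $c[\tau]+\ell[\tau]+\hat w(p,v)$, take such a pair for which $c[\tau]+\ell[\tau]+\hat w(p,v)$ is minimal, remove the present node of $v$ (if any) with its subtree, and insert the node of $v$ with parent $\tau$ and entries $c[\tau]$, $\ell[\tau]+\hat w(p,v)$, $b[\tau]+1$. * *Evaluating.* When $\mathcal T$ is fully extended, let $\tau$ be the node of minimal key among those with $b[\tau]=\alpha$ or $u[\tau]=v_{\rm target}$ (if there is none, the algorithm stops with failure). Evaluate the first $\beta$ edges of $P[\tau]_{\rm tail}$ (all of them if there are fewer) in order. If the evaluated edge $(u,v)$ is collision-free, the entries of the node of $v$ and of its descendants are updated (this edge moves from the tails of their paths to the heads), and if moreover $v=v_{\rm target}$, the algorithm stops and returns the path found. If $(u,v)$ is in collision, the evaluation of the path ends, the edge is removed from the graph, and the nodes of the subtree rooted at the node of $v$ are removed from $\mathcal T$ and then rewired, in the order of their keys, each to its best parent in $\mathcal T$, that is, one that minimizes the key, among the nodes of budget $<\alpha$ other than that of $v_{\rm target}$ (nodes without such a parent stay out of $\mathcal T$). Then $\mathcal T$ is extended again,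 and so on. Let $E_x$ be the set of edges evaluated by LRA* with lookahead $\alpha$ and greediness $x$. **Lemma.** For every shortest-path problem as above and all $\alpha\ge\beta>1$ (the value $\infty$ being allowed for $\alpha$ and $\beta$), $E_1\subseteq E_\beta$. -/

import Mathlib

/-- A shortest-path problem: a directed graph, a positive lazy estimate `lazyCost` of the edge
costs, the set of edges that are in collision, a source and a target vertex. -/
structure SPProblem (V : Type*) where
  graph : Digraph V
  lazyCost : V → V → ℝ
  lazyCost_pos : ∀ u v, graph.Adj u v → 0 < lazyCost u v
  inCollision : V → V → Prop
  source : V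
  target : V

namespace SPProblem

variable {V : Type*}

open Classical in
/-- The true cost `w` of an edge: the lazy estimate if the edge is not in collision, and `∞` if
it is. -/
noncomputable def trueCost (P : SPProblem V) (u v : V) : EReal :=
  if P.inCollision u v then ⊤ else (P.lazyCost u v : EReal)

/-- The lazy cost of the path through the listed vertices: the sum of the lazy estimates of its
edges. -/
def lazyPathCost (P : SPProblem V) (l : List V) : ℝ :=
  (List.zipWith P.lazyCost l l.tail).sum

/-- `l` lists the vertices of a simple path of the graph that starts at the source. -/
def IsSimplePathFromSource (P : SPProblem V) (l : List V) : Prop :=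
  l.head? = some P.source ∧ l.IsChain P.graph.Adj ∧ l.Nodup

/-- No two distinct simple paths from the source have the same (lazy) weight. -/
def NoTies (P : SPProblem V) : Prop :=
  ∀ l₁ l₂ : List V, P.IsSimplePathFromSource l₁ → P.IsSimplePathFromSource l₂ →
    P.lazyPathCost l₁ = P.lazyPathCost l₂ → l₁ = l₂

end SPProblem

/-- The entry `(p, c, ℓ, b)` of the search-tree node of a vertex: the parent (`none` at the root),
the cost of the evaluated portion of the path to the node, the lazy cost of its lazily evaluated
portion, and the budget, which is the number of edges of the latter. -/
structure LRANode (V : Type*) where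
  parent : Option V
  cost : ℝ
  lcost : ℝ
  budget : ℕ

/-- The key of a node: the estimated total cost of the path to it. -/
def LRANode.key {V : Type*} (τ : LRANode V) : ℝ := τ.cost + τ.lcost

/-- A state of LRA*. -/
structure LRAState (V : Type*) where
  /-- the search tree, with at most one node for each vertex -/
  tree : V → Option (LRANode V)
  /-- the edges of the current graph, from which edges found to be in collision are removed -/
  edges : Set (V × V)
  /-- the edges that have been evaluated so far -/
  evaluated : Set (V × V)
  /-- the vertices whose nodes are waiting to be rewired -/
  pending : Set V
  /-- whether a path to the target has been returned -/
  finished : Prop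

namespace LRAState

variable {V : Type*}

/-- The node of `u` is the parent of the node of `v` in the search tree. -/
def IsParent (T : V → Option (LRANode V)) (u v : V) : Prop :=
  ∃ τ, T v = some τ ∧ τ.parent = some u

/-- The vertices of the subtree of the search tree that is rooted at `v`, including `v`. -/
def subtree (T : V → Option (LRANode V)) (v : V) : Set V :=
  {x | Relation.ReflTransGen (IsParent T) v x}

open Classical in
/-- Remove the nodes of the vertices in `S` from the tree. -/
noncomputable def removeNodes (T : V → Option (LRANode V)) (S : Set V) :
    V → Option (LRANode V) :=
  fun x => if x ∈ S then none else T x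

/-- The last `k` edges of the path to `v` in the tree, found by backtracking parents. -/
def lastEdges (T : V → Option (LRANode V)) : ℕ → V → List (V × V)
  | 0, _ => []
  | k + 1, v =>
    match (T v).bind LRANode.parent with
    | none => []
    | some p => lastEdges T k p ++ [(p, v)]

/-- The lazily evaluated tail of the path to `v` in the tree, as a list of edges. -/
def tail (T : V → Option (LRANode V)) (v : V) : List (V × V) :=
  match T v with
  | none => []
  | some τ => lastEdges T τ.budget v

/-- The initial state: the tree consists of the root, and nothing is evaluated. -/
noncomputable def init (P : SPProblem V) : LRAState V where
  tree := open Classical in fun x => if x = P.source then some ⟨none, 0, 0, 0⟩ else none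
  edges := {e | P.graph.Adj e.1 e.2}
  evaluated := ∅
  pending := ∅
  finished := False

/-! ### Rewiring and extending the `α`-band -/

/-- The child node that a tree node `τ` of the vertex `p` generates for the vertex `v`, over an
edge `(p, v)` that is only lazily evaluated. -/
def child (P : SPProblem V) (τ : LRANode V) (p v : V) : LRANode V :=
  ⟨some p, τ.cost, τ.lcost + P.lazyCost p v, τ.budget + 1⟩

/-- In state `s`, the node `τ` of vertex `p` offers `v` a place in the tree, as a child of `p`,
and `v` either has no node yet or its present node has a larger key. Frontier nodes (whose budget
is `α`) and the node of the target have no children. -/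
def Offers (P : SPProblem V) (α : ℕ∞) (s : LRAState V) (p : V) (τ : LRANode V) (v : V) : Prop :=
  s.tree p = some τ ∧ p ≠ P.target ∧ (τ.budget : ℕ∞) < α ∧ (p, v) ∈ s.edges ∧
    ∀ σ, s.tree v = some σ → (child P τ p v).key < σ.key

/-- Among all offers to vertices in `S`, the offer of `p` (with node `τ`) to `v` has the smallest
key. -/
def BestOffer (P : SPProblem V) (α : ℕ∞) (s : LRAState V) (S : Set V)
    (o : V × LRANode V × V) : Prop :=
  o.2.2 ∈ S ∧ Offers P α s o.1 o.2.1 o.2.2 ∧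
    ∀ p τ v, v ∈ S → Offers P α s p τ v →
      (child P o.2.1 o.1 o.2.2).key ≤ (child P τ p v).key

open Classical in
/-- Insert the offered child node of `v`. If `v` already has a node, it is removed together with
its subtree before. -/
noncomputable def attach (P : SPProblem V) (s : LRAState V) (o : V × LRANode V × V) :
    LRAState V :=
  { s with
    tree := Function.update (removeNodes s.tree (subtree s.tree o.2.2)) o.2.2
      (some (child P o.2.1 o.1 o.2.2))
    pending := s.pending \ {o.2.2} }

/-! ### Evaluating edges -/

open Classical in
/-- Update the tree after the edge `(u, v)` from a border node to a child of it has been found to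
be collision-free: in the path to `v` and in the paths to all its descendants, the edge moves from
the lazily evaluated tail to the evaluated head. -/
noncomputable def updateFree (P : SPProblem V) (T : V → Option (LRANode V)) (u v : V) :
    V → Option (LRANode V) :=
  fun x =>
    if x ∈ subtree T v then
      (T x).map fun τ =>
        ⟨τ.parent, τ.cost + P.lazyCost u v, τ.lcost - P.lazyCost u v, τ.budget - 1⟩
    else T x

open Classical in
/-- Evaluate the listed edges in order. The evaluation stops as soon as an edge is found to be in
collision (it is then removed from the graph, and the subtree below it has to be rewired) or an
edge that leads to the target is found to be collision-free (the algorithm then returns). -/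
noncomputable def evaluateEdges (P : SPProblem V) : LRAState V → List (V × V) → LRAState V
  | s, [] => s
  | s, (u, v) :: es =>
    if P.trueCost u v = ⊤ then
      { s with
        tree := removeNodes s.tree (subtree s.tree v)
        edges := s.edges \ {(u, v)}
        evaluated := insert (u, v) s.evaluated
        pending := subtree s.tree v }
    else if v = P.target then
      { s with
        tree := updateFree P s.tree u v
        evaluated := insert (u, v) s.evaluated
        finished := True }
    else
      evaluateEdges P
        { s with
          tree := updateFree P s.tree u v
          evaluated := insert (u, v) s.evaluated } es

/-- `v` has a node in the frontier queue: its budget is `α`, or `v` is the target. -/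
def InFrontier (P : SPProblem V) (α : ℕ∞) (s : LRAState V) (v : V) (τ : LRANode V) : Prop :=
  s.tree v = some τ ∧ ((τ.budget : ℕ∞) = α ∨ v = P.target)

/-- `v` has a node in the frontier queue, of minimal key. -/
def IsMinFrontier (P : SPProblem V) (α : ℕ∞) (s : LRAState V) (v : V) : Prop :=
  ∃ τ, InFrontier P α s v τ ∧ ∀ v' τ', InFrontier P α s v' τ' → τ.key ≤ τ'.key

/-- The first `β` elements of a list (all of them if it is shorter). -/
noncomputable def takeFirst {A : Type*} (β : ℕ∞) (l : List A) : List A :=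
  l.take (min β (l.length : ℕ∞)).toNat

open Classical in
/-- One elementary step of LRA* with lookahead `α` and greediness `β`.
* If nodes are waiting to be rewired, the one with the best offer is rewired to its best parent;
  those that receive no offer stay out of the tree.
* Otherwise the `α`-band is extended, in the order of the keys, as long as this is possible.
* Otherwise a node of minimal key is chosen from the frontier queue, and the first `β` edges of the
  lazily evaluated tail of its path are evaluated. If the queue is empty, the algorithm has failed
  and nothing happens any more. -/
noncomputable def step (P : SPProblem V) (α β : ℕ∞) (s : LRAState V) : LRAState V :=
  if s.finished then s
  else if h : ∃ o, BestOffer P α s s.pending o then attach P s h.choose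
  else if s.pending.Nonempty then { s with pending := ∅ }
  else if h : ∃ o, BestOffer P α s Set.univ o then attach P s h.choose
  else if h : ∃ v, IsMinFrontier P α s v then
    evaluateEdges P s (takeFirst β (tail s.tree h.choose))
  else s

end LRAState

/-- The set of edges that LRA* with lookahead `α` and greediness `β` evaluates in its run on the
shortest-path problem `P`. -/
def LRAEvaluatedEdges {V : Type*} (P : SPProblem V) (α β : ℕ∞) : Set (V × V) :=
  {e | ∃ k : ℕ, e ∈ ((LRAState.step P α β)^[k] (LRAState.init P)).evaluated}

/-!
Both runs keep a search tree in which every evaluated head is a cheapest path of the current graph.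
Suppose that the run of greediness 1 is about to evaluate the first edge `(u, v)` of the tail of its
frontier path, a path of minimal key, and that the other run never evaluates `(u, v)`. Since no two
paths tie, a cheapest path has a unique predecessor edge at each of its vertices, so the other run
evaluates no edge of the frontier path from `(u, v)` on: a cheapest evaluated path to a later vertex
would contain `(u, v)`. All these edges are hence still in its final graph, and its last fully
extended tree contains either the frontier path or a frontier node of at most the same key. It
follows that the other run does not fail: it returns a path to the target that is at most as costly.
That path consists of edges known to be collision-free, so it is also available to the run of
greediness 1, and its cost cannot be smaller than the key of the frontier path. Equal costs mean
equal paths, so the frontier path, including `(u, v)`, has been evaluated after all.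
-/

/-! ### Walks and distances -/

namespace SPProblem

variable {V : Type*} {P : SPProblem V} {E F : Set (V × V)} {u v : V} {b c : ℝ}

/-- There is a walk of lazy cost `c` from the source to `v` along edges in `E`. -/
inductive HasWalk (P : SPProblem V) (E : Set (V × V)) : V → ℝ → Prop
  | source : HasWalk P E P.source 0
  | step {u v : V} {c : ℝ} : HasWalk P E u c → (u, v) ∈ E → HasWalk P E v (c + P.lazyCost u v)

/-- The lazy costs of the walks from the source to `v` along edges in `E`. The least of them, if
there is one, is the distance of `v`. -/
def walkCosts (P : SPProblem V) (E : Set (V × V)) (v : V) : Set ℝ := {c | P.HasWalk E v c}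

theorem zero_mem_walkCosts_source : 0 ∈ P.walkCosts E P.source := HasWalk.source

theorem add_mem_walkCosts (hc : c ∈ P.walkCosts E u) (he : (u, v) ∈ E) :
    c + P.lazyCost u v ∈ P.walkCosts E v :=
  HasWalk.step hc he

theorem walkCosts_mono (h : E ⊆ F) (v : V) : P.walkCosts E v ⊆ P.walkCosts F v := by
  intro c hc
  induction hc with
  | source => exact HasWalk.source
  | step _ he ih => exact HasWalk.step ih (h he)

theorem nonneg_of_mem_walkCosts (hE : E ⊆ {e | P.graph.Adj e.1 e.2})
    (hc : c ∈ P.walkCosts E v) : 0 ≤ c := by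
  induction hc with
  | source => exact le_rfl
  | step _ he ih => exact add_nonneg ih (P.lazyCost_pos _ _ (hE he)).le

theorem mem_lowerBounds_walkCosts_of_add (he : (u, v) ∈ E)
    (hc : c + P.lazyCost u v ∈ lowerBounds (P.walkCosts E v)) :
    c ∈ lowerBounds (P.walkCosts E u) :=
  fun _ hu => le_of_add_le_add_right (hc (add_mem_walkCosts hu he))

theorem lazyPathCost_concat (P : SPProblem V) (l : List V) (u v : V) :
    P.lazyPathCost (l ++ [u] ++ [v]) = P.lazyPathCost (l ++ [u]) + P.lazyCost u v := by
  induction l with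
  | nil => simp [lazyPathCost]
  | cons a l ih =>
    cases l <;> simp_all [lazyPathCost, add_assoc]

/-- `l ++ [v]` is a simple path of lazy cost `c` from the source to `v`, all of whose vertices have
distance at most `c` in `E`. -/
structure IsShortPath (P : SPProblem V) (E : Set (V × V)) (l : List V) (v : V) (c : ℝ) :
    Prop where
  isSimple : P.IsSimplePathFromSource (l ++ [v])
  cost_eq : P.lazyPathCost (l ++ [v]) = c
  exists_le : ∀ y ∈ l ++ [v], ∃ b ∈ P.walkCosts E y, b ≤ c

theorem IsShortPath.concat (hE : E ⊆ {e | P.graph.Adj e.1 e.2}) {l : List V}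
    (h : P.IsShortPath E l u c) (he : (u, v) ∈ E) (hc : c ∈ P.walkCosts E u)
    (hmin : c + P.lazyCost u v ∈ lowerBounds (P.walkCosts E v)) :
    P.IsShortPath E (l ++ [u]) v (c + P.lazyCost u v) := by
  have hpos : 0 < P.lazyCost u v := P.lazyCost_pos u v (hE he)
  have hv : v ∉ l ++ [u] := fun hv => by
    obtain ⟨b, hb, hbc⟩ := h.exists_le v hv
    linarith [hmin hb]
  obtain ⟨hhead, hchain, hnodup⟩ := h.isSimple
  refine ⟨⟨?_, ?_, ?_⟩, by rw [lazyPathCost_concat, h.cost_eq], ?_⟩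
  · rw [List.head?_append, hhead, Option.some_or]
  · refine List.isChain_append.2 ⟨hchain, List.isChain_singleton v, ?_⟩
    simpa using hE he
  · exact List.concat_eq_append ▸ (List.nodup_concat _ _).2 ⟨hv, hnodup⟩
  · intro y hy
    rcases List.mem_append.1 hy with hy | hy
    · obtain ⟨b, hb, hbc⟩ := h.exists_le y hy
      exact ⟨b, hb, by linarith⟩
    · obtain rfl := List.mem_singleton.1 hy
      exact ⟨_, add_mem_walkCosts hc he, le_rfl⟩

theorem exists_isShortPath (hE : E ⊆ {e | P.graph.Adj e.1 e.2})
    (hc : IsLeast (P.walkCosts E v) c) : ∃ l, P.IsShortPath E l v c := by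
  obtain ⟨hwalk, hmin⟩ := hc
  induction hwalk with
  | source =>
    refine ⟨[], by simp [IsSimplePathFromSource], by simp [lazyPathCost], fun y hy => ?_⟩
    obtain rfl := List.mem_singleton.1 hy
    exact ⟨0, zero_mem_walkCosts_source, le_rfl⟩
  | step hu he ih =>
    obtain ⟨l, hl⟩ := ih (mem_lowerBounds_walkCosts_of_add he hmin)
    exact ⟨_, hl.concat hE he hu hmin⟩

theorem NoTies.eq_of_isLeast (hP : P.NoTies) (hE : E ⊆ {e | P.graph.Adj e.1 e.2})
    (hu : IsLeast (P.walkCosts E u) c) (hv : IsLeast (P.walkCosts E v) c) : u = v := by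
  obtain ⟨l, hl⟩ := exists_isShortPath hE hu
  obtain ⟨m, hm⟩ := exists_isShortPath hE hv
  have hlm := hP _ _ hl.isSimple hm.isSimple (hl.cost_eq.trans hm.cost_eq.symm)
  simpa using (List.append_inj' hlm rfl).2

theorem NoTies.predecessor_unique (hP : P.NoTies) (hE : E ⊆ {e | P.graph.Adj e.1 e.2})
    {p q : V} (hp : b ∈ P.walkCosts E p) (hq : c ∈ P.walkCosts E q) (hpv : (p, v) ∈ E)
    (hqv : (q, v) ∈ E) (hmin : b + P.lazyCost p v ∈ lowerBounds (P.walkCosts E v))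
    (heq : b + P.lazyCost p v = c + P.lazyCost q v) : p = q := by
  have hmin' : c + P.lazyCost q v ∈ lowerBounds (P.walkCosts E v) := heq ▸ hmin
  obtain ⟨l, hl⟩ := exists_isShortPath hE ⟨hp, mem_lowerBounds_walkCosts_of_add hpv hmin⟩
  obtain ⟨m, hm⟩ := exists_isShortPath hE ⟨hq, mem_lowerBounds_walkCosts_of_add hqv hmin'⟩
  have hlv := hl.concat hE hpv hp hmin
  have hmv := hm.concat hE hqv hq hmin'
  have hlm := hP _ _ hlv.isSimple hmv.isSimple (hlv.cost_eq.trans (heq.trans hmv.cost_eq.symm))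
  simpa using (List.append_inj' (List.append_inj' hlm rfl).1 rfl).2

theorem trueCost_eq_top_iff : P.trueCost u v = ⊤ ↔ P.inCollision u v := by
  unfold trueCost
  split_ifs with h <;> simp [h]

end SPProblem

/-! ### The search tree and its invariant -/

namespace LRAState

variable {V : Type*} {P : SPProblem V} {α : ℕ∞} {s s' : LRAState V}
  {T : V → Option (LRANode V)} {p q u v x y : V} {σ τ ρ : LRANode V}

theorem mem_subtree_self (T : V → Option (LRANode V)) (v : V) : v ∈ subtree T v :=
  Relation.ReflTransGen.refl

theorem IsParent.mem_subtree (h : IsParent T p x) (hp : p ∈ subtree T v) : x ∈ subtree T v :=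
  Relation.ReflTransGen.tail hp h

theorem IsParent.unique (hp : IsParent T p x) (hq : IsParent T q x) : p = q := by
  obtain ⟨τ, hτ, hp⟩ := hp
  obtain ⟨ρ, hρ, hq⟩ := hq
  obtain rfl : τ = ρ := Option.some.inj (hτ.symm.trans hρ)
  exact Option.some.inj (hp.symm.trans hq)

theorem IsParent.parent_mem_subtree (h : IsParent T p x) (hx : x ∈ subtree T v) (hne : x ≠ v) :
    p ∈ subtree T v := by
  obtain rfl | ⟨q, hq, hqx⟩ := Relation.ReflTransGen.cases_tail hx
  · exact absurd rfl hne
  · exact hqx.unique h ▸ hq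

theorem removeNodes_eq_some {S : Set V} :
    removeNodes T S x = some τ ↔ x ∉ S ∧ T x = some τ := by
  unfold removeNodes
  split_ifs with h <;> simp [h]

theorem child_key (P : SPProblem V) (τ : LRANode V) (p v : V) :
    (child P τ p v).key = τ.key + P.lazyCost p v := by
  simp only [child, LRANode.key, add_assoc]

/-- The path to `v` in the tree is completely evaluated. -/
def IsHead (T : V → Option (LRANode V)) (v : V) : Prop := ∃ τ, T v = some τ ∧ τ.budget = 0

theorem isHead_iff (hv : T v = some τ) : IsHead T v ↔ τ.budget = 0 := by
  simp only [IsHead, hv, Option.some.injEq, exists_eq_left']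

/-- The path to `v` in the tree, if `v` has a node, is a cheapest path of the current graph. -/
def IsShortest (P : SPProblem V) (s : LRAState V) (v : V) : Prop :=
  ∀ τ, s.tree v = some τ → τ.key ∈ lowerBounds (P.walkCosts s.edges v)

/-- The node `τ` of `v` is a child of the node `σ` of `p`, over an edge of the current graph that
either belongs to the evaluated head of the path to `v` or is the last edge of its tail. -/
structure TreeEdge (P : SPProblem V) (s : LRAState V) (p : V) (σ : LRANode V) (v : V)
    (τ : LRANode V) : Prop where
  node_parent : s.tree p = some σ
  node_child : s.tree v = some τ
  parent_eq : τ.parent = some p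
  mem_edges : (p, v) ∈ s.edges
  ne_target : p ≠ P.target
  key_eq : τ.key = σ.key + P.lazyCost p v
  budget : (τ.budget = 0 ∧ σ.budget = 0 ∧ (p, v) ∈ s.evaluated) ∨ τ.budget = σ.budget + 1

namespace TreeEdge

theorem mono (h : TreeEdge P s p σ v τ) (hp : s'.tree p = some σ) (hv : s'.tree v = some τ)
    (he : (p, v) ∈ s'.edges) (hev : s.evaluated ⊆ s'.evaluated) : TreeEdge P s' p σ v τ :=
  ⟨hp, hv, h.parent_eq, he, h.ne_target, h.key_eq,
    h.budget.imp_left fun ⟨hτ, hσ, hpv⟩ => ⟨hτ, hσ, hev hpv⟩⟩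

theorem isParent (h : TreeEdge P s p σ v τ) : IsParent s.tree p v :=
  ⟨τ, h.node_child, h.parent_eq⟩

theorem isHead_parent (h : TreeEdge P s p σ v τ) (hv : IsHead s.tree v) : IsHead s.tree p := by
  rw [isHead_iff h.node_child] at hv
  refine ⟨σ, h.node_parent, ?_⟩
  have := h.budget
  omega

theorem isShortest_parent (h : TreeEdge P s p σ v τ) (hv : IsShortest P s v) :
    IsShortest P s p := by
  intro ρ hρ
  obtain rfl : σ = ρ := Option.some.inj (h.node_parent.symm.trans hρ)
  exact SPProblem.mem_lowerBounds_walkCosts_of_add h.mem_edges (h.key_eq ▸ hv τ h.node_child)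

theorem budget_eq_of_not_isHead (h : TreeEdge P s p σ v τ) (hv : ¬ IsHead s.tree v) :
    τ.budget = σ.budget + 1 :=
  h.budget.resolve_left fun h0 => hv ⟨τ, h.node_child, h0.1⟩

end TreeEdge

/-- The invariant of LRA*: the entries of the nodes are consistent with the tree, the evaluated
collision-free edges are the tree edges of the evaluated heads of the paths, and these heads are
cheapest paths. -/
structure Inv (P : SPProblem V) (α : ℕ∞) (s : LRAState V) : Prop where
  root : s.tree P.source = some ⟨none, 0, 0, 0⟩
  exists_treeEdge : ∀ v τ, s.tree v = some τ → v ≠ P.source → ∃ p σ, TreeEdge P s p σ v τ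
  budget_le : ∀ v τ, s.tree v = some τ → (τ.budget : ℕ∞) ≤ α
  mem_edges_iff : ∀ u v, (u, v) ∈ s.edges ↔
    P.graph.Adj u v ∧ ¬ ((u, v) ∈ s.evaluated ∧ P.inCollision u v)
  isShortest_of_isHead : ∀ v, IsHead s.tree v → IsShortest P s v
  isHead_of_mem_evaluated : ∀ u v, (u, v) ∈ s.evaluated → IsHead s.tree u
  isHead_child : ∀ u v, (u, v) ∈ s.evaluated → ¬ P.inCollision u v →
    IsParent s.tree u v ∧ IsHead s.tree v
  finished_or_eq : IsHead s.tree P.target → s.finished ∨ P.target = P.source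
  isHead_of_finished : s.finished → IsHead s.tree P.target

namespace Inv

theorem edges_subset (h : Inv P α s) : s.edges ⊆ {e | P.graph.Adj e.1 e.2} :=
  fun e he => ((h.mem_edges_iff e.1 e.2).1 he).1

theorem lazyCost_pos (h : Inv P α s) (he : (u, v) ∈ s.edges) : 0 < P.lazyCost u v :=
  P.lazyCost_pos u v (h.edges_subset he)

theorem isHead_source (h : Inv P α s) : IsHead s.tree P.source := ⟨_, h.root, rfl⟩

theorem ne_source_of_isParent (h : Inv P α s) (hp : IsParent s.tree p v) : v ≠ P.source := by
  rintro rfl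
  obtain ⟨τ, hτ, hp⟩ := hp
  cases h.root.symm.trans hτ
  cases hp

theorem exists_treeEdge_of_isParent (h : Inv P α s) (hp : IsParent s.tree p v) :
    ∃ σ τ, TreeEdge P s p σ v τ := by
  obtain ⟨τ, hτ, -⟩ := id hp
  obtain ⟨q, σ, hq⟩ := h.exists_treeEdge v τ hτ (h.ne_source_of_isParent hp)
  obtain rfl := hp.unique hq.isParent
  exact ⟨σ, τ, hq⟩

theorem key_lt_of_treeEdge (h : Inv P α s) (hp : TreeEdge P s p σ v τ) : σ.key < τ.key := by
  have := h.lazyCost_pos hp.mem_edges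
  linarith [hp.key_eq]

theorem tree_induction [Finite V] (h : Inv P α s) {motive : V → LRANode V → Prop}
    (root : motive P.source ⟨none, 0, 0, 0⟩)
    (step : ∀ p σ v τ, TreeEdge P s p σ v τ → motive p σ → motive v τ) (hv : s.tree v = some τ) :
    motive v τ := by
  let key : V → ℝ := fun x => (s.tree x).elim 0 LRANode.key
  have key_eq {x ρ} (hx : s.tree x = some ρ) : key x = ρ.key := by simp only [key, hx, Option.elim]
  have wf : WellFounded (Function.onFun (· < ·) key) := by
    have : IsStrictOrder V (Function.onFun (· < ·) key) :=
      { irrefl := fun _ => lt_irrefl _, trans := fun _ _ _ => lt_trans }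
    exact Finite.wellFounded_of_trans_of_irrefl _
  induction v using wf.induction generalizing τ with
  | _ v ih =>
    by_cases hs : v = P.source
    · subst hs
      cases h.root.symm.trans hv
      exact root
    · obtain ⟨p, σ, hp⟩ := h.exists_treeEdge v τ hv hs
      refine step p σ v τ hp (ih p ?_ hp.node_parent)
      change key p < key v
      rw [key_eq hp.node_parent, key_eq hp.node_child]
      exact h.key_lt_of_treeEdge hp

theorem key_mem_walkCosts [Finite V] (h : Inv P α s) (hv : s.tree v = some τ) :
    τ.key ∈ P.walkCosts s.edges v := by
  refine h.tree_induction (motive := fun v τ => τ.key ∈ P.walkCosts s.edges v) ?_ ?_ hv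
  · simpa only [LRANode.key, add_zero] using SPProblem.zero_mem_walkCosts_source
  · intro p σ v τ hp ih
    exact hp.key_eq ▸ SPProblem.add_mem_walkCosts ih hp.mem_edges

theorem exists_key_le_of_mem_subtree (h : Inv P α s) (hx : x ∈ subtree s.tree v)
    (hτ : s.tree x = some τ) : ∃ σ, s.tree v = some σ ∧ σ.key ≤ τ.key := by
  change Relation.ReflTransGen _ v x at hx
  induction hx generalizing τ with
  | refl => exact ⟨τ, hτ, le_rfl⟩
  | tail _ hpx ih =>
    obtain ⟨σ, ρ, hpx⟩ := h.exists_treeEdge_of_isParent hpx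
    obtain rfl : ρ = τ := Option.some.inj (hpx.node_child.symm.trans hτ)
    obtain ⟨π, hπ, hle⟩ := ih hpx.node_parent
    exact ⟨π, hπ, hle.trans (h.key_lt_of_treeEdge hpx).le⟩

theorem isHead_of_mem_subtree (h : Inv P α s) (hx : x ∈ subtree s.tree v)
    (hhead : IsHead s.tree x) : IsHead s.tree v := by
  change Relation.ReflTransGen _ v x at hx
  induction hx with
  | refl => exact hhead
  | tail _ hpx ih =>
    obtain ⟨σ, τ, hpx⟩ := h.exists_treeEdge_of_isParent hpx
    exact ih (hpx.isHead_parent hhead)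

theorem isShortest_of_mem_subtree (h : Inv P α s) (hx : x ∈ subtree s.tree v)
    (hshort : IsShortest P s x) : IsShortest P s v := by
  change Relation.ReflTransGen _ v x at hx
  induction hx with
  | refl => exact hshort
  | tail _ hpx ih =>
    obtain ⟨σ, τ, hpx⟩ := h.exists_treeEdge_of_isParent hpx
    exact ih (hpx.isShortest_parent hshort)

theorem two_le_budget_of_mem_subtree (h : Inv P α s) (hv : ¬ IsHead s.tree v)
    (hx : x ∈ subtree s.tree v) (hne : x ≠ v) (hτ : s.tree x = some τ) : 2 ≤ τ.budget := by
  obtain rfl | ⟨p, hp, hpx⟩ := Relation.ReflTransGen.cases_tail hx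
  · exact absurd rfl hne
  obtain ⟨σ, ρ, hpx⟩ := h.exists_treeEdge_of_isParent hpx
  obtain rfl : ρ = τ := Option.some.inj (hpx.node_child.symm.trans hτ)
  have hp' : ¬ IsHead s.tree p := fun hp' => hv (h.isHead_of_mem_subtree hp hp')
  have hσ : σ.budget ≠ 0 := (isHead_iff hpx.node_parent).not.1 hp'
  have := hpx.budget_eq_of_not_isHead fun hx' => hp' (hpx.isHead_parent hx')
  omega

theorem init (P : SPProblem V) (α : ℕ∞) : Inv P α (init P) := by
  have eq_root {v τ} (hv : (LRAState.init P).tree v = some τ) :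
      v = P.source ∧ τ = ⟨none, 0, 0, 0⟩ := by
    simp only [LRAState.init] at hv
    split_ifs at hv with hs
    exact ⟨hs, (Option.some.inj hv).symm⟩
  constructor
  · simp only [LRAState.init, if_true]
  · exact fun v τ hv hs => absurd (eq_root hv).1 hs
  · intro v τ hv
    simp only [(eq_root hv).2, Nat.cast_zero, zero_le]
  · exact fun u v => ⟨fun huv => ⟨huv, fun h => h.1⟩, And.left⟩
  · intro v _ τ hτ c hc
    rw [(eq_root hτ).2]
    simpa only [LRANode.key, add_zero] using SPProblem.nonneg_of_mem_walkCosts subset_rfl hc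
  · exact fun u v huv => absurd huv (Set.notMem_empty _)
  · exact fun u v huv => absurd huv (Set.notMem_empty _)
  · rintro ⟨τ, hτ, -⟩
    exact .inr (eq_root hτ).1
  · exact False.elim

theorem replaceTree (h : Inv P α s) (S : Set V)
    (hhead : ∀ x σ, σ.budget = 0 → (T x = some σ ↔ s.tree x = some σ))
    (hedge : ∀ x τ, T x = some τ → x ≠ P.source →
      ∃ p σ, TreeEdge P { s with tree := T, pending := S } p σ x τ)
    (hbudget : ∀ x τ, T x = some τ → (τ.budget : ℕ∞) ≤ α) :
    Inv P α { s with tree := T, pending := S } := by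
  have isHead_congr (x : V) : IsHead T x ↔ IsHead s.tree x :=
    exists_congr fun σ => and_congr_left fun h0 => hhead x σ h0
  constructor
  · exact (hhead _ _ rfl).2 h.root
  · exact hedge
  · exact hbudget
  · exact h.mem_edges_iff
  · rintro v ⟨σ, hσ, h0⟩ τ hτ
    obtain rfl : σ = τ := Option.some.inj (hσ.symm.trans hτ)
    have hσ := (hhead v σ h0).1 hσ
    exact h.isShortest_of_isHead v ⟨σ, hσ, h0⟩ σ hσ
  · exact fun u v huv => (isHead_congr u).2 (h.isHead_of_mem_evaluated u v huv)
  · intro u v huv hc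
    obtain ⟨⟨τ, hτ, hp⟩, hv⟩ := h.isHead_child u v huv hc
    exact ⟨⟨τ, (hhead v τ ((isHead_iff hτ).1 hv)).2 hτ, hp⟩, (isHead_congr v).2 hv⟩
  · exact fun ht => h.finished_or_eq ((isHead_congr _).1 ht)
  · exact fun hf => (isHead_congr _).2 (h.isHead_of_finished hf)

theorem prune (h : Inv P α s) (S : Set V) (hv : ¬ IsHead s.tree v) :
    Inv P α { s with tree := removeNodes s.tree (subtree s.tree v), pending := S } := by
  refine h.replaceTree S (fun x σ h0 => ?_) (fun x τ hx hs => ?_) fun x τ hx =>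
    h.budget_le x τ (removeNodes_eq_some.1 hx).2
  · exact removeNodes_eq_some.trans (and_iff_right_of_imp fun hx hm =>
      hv (h.isHead_of_mem_subtree hm ⟨σ, hx, h0⟩))
  · obtain ⟨hm, hx'⟩ := removeNodes_eq_some.1 hx
    obtain ⟨p, σ, hp⟩ := h.exists_treeEdge x τ hx' hs
    refine ⟨p, σ, hp.mono ?_ hx hp.mem_edges subset_rfl⟩
    exact removeNodes_eq_some.2 ⟨fun hpm => hm (hp.isParent.mem_subtree hpm), hp.node_parent⟩

theorem addLeaf [DecidableEq V] (h : Inv P α s) (S : Set V) (hv : s.tree v = none)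
    (ho : Offers P α s p τ v) :
    Inv P α { s with
      tree := Function.update s.tree v (some (child P τ p v))
      pending := S } := by
  obtain ⟨hp, hpt, hb, he, -⟩ := ho
  have update_of_node {x ρ} (hx : s.tree x = some ρ) :
      Function.update s.tree v (some (child P τ p v)) x = some ρ := by
    rw [Function.update_of_ne, hx]
    rintro rfl
    exact Option.some_ne_none ρ (hx.symm.trans hv)
  have update_cases {x ρ} (hx : Function.update s.tree v (some (child P τ p v)) x = some ρ) :
      (x = v ∧ ρ = child P τ p v) ∨ s.tree x = some ρ := by
    rcases eq_or_ne x v with rfl | hne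
    · rw [Function.update_self] at hx
      exact .inl ⟨rfl, (Option.some.inj hx).symm⟩
    · exact .inr ((Function.update_of_ne hne _ _).symm.trans hx)
  refine h.replaceTree S (fun x σ h0 => ⟨fun hx => ?_, update_of_node⟩) (fun x ρ hx hs => ?_)
    fun x ρ hx => ?_ <;> rcases update_cases hx with ⟨rfl, rfl⟩ | hx'
  · cases h0
  · exact hx'
  · exact ⟨p, τ, update_of_node hp, hx, rfl, he, hpt, child_key .., .inr rfl⟩
  · obtain ⟨q, σ, hq⟩ := h.exists_treeEdge x ρ hx' hs
    exact ⟨q, σ, hq.mono (update_of_node hq.node_parent) hx hq.mem_edges subset_rfl⟩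
  · exact_mod_cast Order.add_one_le_of_lt hb
  · exact h.budget_le x ρ hx'

theorem recordCollision (h : Inv P α s) (S : Set V) (hv : s.tree v = none)
    (hu : IsHead s.tree u) (hc : P.inCollision u v) :
    Inv P α { s with
      edges := s.edges \ {(u, v)}
      evaluated := insert (u, v) s.evaluated
      pending := S } := by
  constructor
  · exact h.root
  · intro x τ hx hs
    obtain ⟨p, σ, hp⟩ := h.exists_treeEdge x τ hx hs
    refine ⟨p, σ, hp.mono hp.node_parent hx ⟨hp.mem_edges, ?_⟩ (Set.subset_insert _ _)⟩
    rintro ⟨-⟩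
    exact Option.some_ne_none τ (hx.symm.trans hv)
  · exact h.budget_le
  · intro x y
    simp only [Set.mem_sdiff, Set.mem_singleton_iff, Set.mem_insert_iff, h.mem_edges_iff x y]
    by_cases hxy : (x, y) = (u, v)
    · obtain ⟨rfl, rfl⟩ := Prod.ext_iff.1 hxy
      simp [hc]
    · simp [hxy]
  · exact fun x hx τ hτ => lowerBounds_mono_set (SPProblem.walkCosts_mono Set.sdiff_subset x)
      (h.isShortest_of_isHead x hx τ hτ)
  · rintro x y (hxy | hxy)
    · cases hxy
      exact hu
    · exact h.isHead_of_mem_evaluated x y hxy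
  · rintro x y (hxy | hxy) hxy'
    · cases hxy
      exact absurd hc hxy'
    · exact h.isHead_child x y hxy hxy'
  · exact h.finished_or_eq
  · exact h.isHead_of_finished

end Inv

end LRAState

namespace LRAState

variable {V : Type*} {P : SPProblem V} {α : ℕ∞} {s : LRAState V}
  {T : V → Option (LRANode V)} {p u v x : V} {σ τ ρ : LRANode V}

theorem Offers.not_isHead [Finite V] (ho : Offers P α s p τ v) (h : Inv P α s) :
    ¬ IsHead s.tree v := by
  rintro ⟨σ, hσ, h0⟩
  obtain ⟨hp, -, -, he, hk⟩ := ho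
  have hlt := hk σ hσ
  rw [child_key] at hlt
  exact hlt.not_ge (h.isShortest_of_isHead v ⟨σ, hσ, h0⟩ σ hσ
    (SPProblem.add_mem_walkCosts (h.key_mem_walkCosts hp) he))

theorem Offers.child_key_lt_of_mem_subtree (ho : Offers P α s p τ v) (h : Inv P α s)
    (hx : x ∈ subtree s.tree v) (hρ : s.tree x = some ρ) : (child P τ p v).key < ρ.key := by
  obtain ⟨σ, hσ, hle⟩ := h.exists_key_le_of_mem_subtree hx hρ
  exact (ho.2.2.2.2 σ hσ).trans_le hle

theorem Offers.not_mem_subtree (ho : Offers P α s p τ v) (h : Inv P α s) :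
    p ∉ subtree s.tree v := by
  intro hm
  have hlt := ho.child_key_lt_of_mem_subtree h hm ho.1
  rw [child_key] at hlt
  linarith [h.lazyCost_pos ho.2.2.2.1]

theorem attach_tree_self (P : SPProblem V) (s : LRAState V) (p v : V) (τ : LRANode V) :
    (attach P s (p, τ, v)).tree v = some (child P τ p v) := by
  classical
  exact Function.update_self v _ _

theorem attach_tree_of_not_mem (P : SPProblem V) (p : V) (τ : LRANode V)
    (hx : x ∉ subtree s.tree v) : (attach P s (p, τ, v)).tree x = s.tree x := by
  classical
  have hne : x ≠ v := by
    rintro rfl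
    exact hx (mem_subtree_self _ _)
  exact (Function.update_of_ne hne _ _).trans (if_neg hx)

theorem attach_tree_cases (hx : (attach P s (p, τ, v)).tree x = some ρ) :
    (x = v ∧ ρ = child P τ p v) ∨ (x ∉ subtree s.tree v ∧ s.tree x = some ρ) := by
  classical
  rcases eq_or_ne x v with rfl | hne
  · rw [attach_tree_self] at hx
    exact .inl ⟨rfl, (Option.some.inj hx).symm⟩
  · exact .inr (removeNodes_eq_some.1 ((Function.update_of_ne hne _ _).symm.trans hx))

theorem Inv.attach [Finite V] (h : Inv P α s) (ho : Offers P α s p τ v) :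
    Inv P α (attach P s (p, τ, v)) := by
  classical
  have hv : removeNodes s.tree (subtree s.tree v) v = none := if_pos (mem_subtree_self _ _)
  have hp : removeNodes s.tree (subtree s.tree v) p = some τ :=
    removeNodes_eq_some.2 ⟨ho.not_mem_subtree h, ho.1⟩
  refine (h.prune s.pending (ho.not_isHead h)).addLeaf _ hv ⟨hp, ho.2.1, ho.2.2.1, ho.2.2.2.1, ?_⟩
  exact fun σ hσ => absurd (hv.symm.trans hσ) (Option.some_ne_none σ).symm

/-- The state after the evaluation of the edge `(u, v)`, which is found to be in collision. -/
noncomputable def collide (s : LRAState V) (u v : V) : LRAState V where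
  tree := removeNodes s.tree (subtree s.tree v)
  edges := s.edges \ {(u, v)}
  evaluated := insert (u, v) s.evaluated
  pending := subtree s.tree v
  finished := s.finished

theorem Inv.collide (h : Inv P α s) (hu : IsHead s.tree u) (hv : ¬ IsHead s.tree v)
    (hc : P.inCollision u v) : Inv P α (collide s u v) := by
  obtain ⟨σ, hσ, h0⟩ := hu
  refine (h.prune s.pending hv).recordCollision _ (if_pos (mem_subtree_self _ _)) ?_ hc
  exact ⟨σ, removeNodes_eq_some.2
    ⟨fun hm => hv (h.isHead_of_mem_subtree hm ⟨σ, hσ, h0⟩), hσ⟩, h0⟩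

/-- The state after the evaluation of the edge `(u, v)`, which is found to be collision-free. -/
noncomputable def freeEdge (P : SPProblem V) (s : LRAState V) (u v : V) : LRAState V where
  tree := updateFree P s.tree u v
  edges := s.edges
  evaluated := insert (u, v) s.evaluated
  pending := s.pending
  finished := s.finished ∨ v = P.target

open Classical in
theorem evaluateEdges_cons (P : SPProblem V) (s : LRAState V) (u v : V) (es : List (V × V)) :
    evaluateEdges P s ((u, v) :: es) =
      if P.inCollision u v then collide s u v
      else if v = P.target then freeEdge P s u v
      else evaluateEdges P (freeEdge P s u v) es := by
  rw [evaluateEdges]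
  simp only [SPProblem.trueCost_eq_top_iff]
  split_ifs with hc ht
  · rfl
  · simp only [freeEdge, ht, or_true]
  · simp only [freeEdge, ht, or_false]

/-- The entries of a node below the edge `(u, v)` after this edge has moved from the tail of its
path to the head. -/
def freed (P : SPProblem V) (u v : V) (τ : LRANode V) : LRANode V :=
  ⟨τ.parent, τ.cost + P.lazyCost u v, τ.lcost - P.lazyCost u v, τ.budget - 1⟩

theorem freed_key (P : SPProblem V) (u v : V) (τ : LRANode V) : (freed P u v τ).key = τ.key := by
  simp only [freed, LRANode.key, add_add_sub_cancel]

theorem updateFree_of_mem (hx : x ∈ subtree T v) (hτ : T x = some τ) :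
    updateFree P T u v x = some (freed P u v τ) :=
  (if_pos hx).trans (congrArg _ hτ)

theorem updateFree_of_not_mem (hx : x ∉ subtree T v) : updateFree P T u v x = T x :=
  if_neg hx

theorem updateFree_cases (hx : updateFree P T u v x = some ρ) :
    (x ∈ subtree T v ∧ ∃ τ, T x = some τ ∧ ρ = freed P u v τ) ∨
      (x ∉ subtree T v ∧ T x = some ρ) := by
  by_cases hm : x ∈ subtree T v
  · obtain ⟨τ, hτ, rfl⟩ := Option.map_eq_some_iff.1 ((if_pos hm).symm.trans hx)
    exact .inl ⟨hm, τ, hτ, rfl⟩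
  · exact .inr ⟨hm, updateFree_of_not_mem hm ▸ hx⟩

theorem map_updateFree {A : Type*} {f : LRANode V → A} (hf : ∀ τ, f (freed P u v τ) = f τ)
    (T : V → Option (LRANode V)) (x : V) : (updateFree P T u v x).map f = (T x).map f := by
  unfold updateFree
  split_ifs with hx
  · rw [Option.map_map]
    exact congrArg (fun g => (T x).map g) (funext hf)
  · rfl

theorem isParent_updateFree (P : SPProblem V) (T : V → Option (LRANode V)) (u v : V) :
    IsParent (updateFree P T u v) = IsParent T := by
  funext p x
  simp only [IsParent, ← Option.map_eq_some_iff, map_updateFree (f := LRANode.parent) fun _ => rfl]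

theorem isShortest_freeEdge :
    IsShortest P (freeEdge P s u v) x ↔ IsShortest P s x := by
  have forall_key (t : LRAState V) : IsShortest P t x ↔
      ∀ k, (t.tree x).map LRANode.key = some k → k ∈ lowerBounds (P.walkCosts t.edges x) := by
    simp only [IsShortest, Option.map_eq_some_iff, forall_exists_index, and_imp,
      forall_apply_eq_imp_iff₂]
  rw [forall_key, forall_key]
  simp only [freeEdge, map_updateFree (freed_key P u v)]

namespace Inv

theorem freeEdge_tree_of_isHead (h : Inv P α s) (hv : ¬ IsHead s.tree v) (hx : IsHead s.tree x) :
    (freeEdge P s u v).tree x = s.tree x :=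
  updateFree_of_not_mem fun hm => hv (h.isHead_of_mem_subtree hm hx)

theorem isHead_freeEdge (h : Inv P α s) (hu : IsHead s.tree u) (huv : IsParent s.tree u v)
    (hv : ¬ IsHead s.tree v) :
    IsHead (freeEdge P s u v).tree x ↔ IsHead s.tree x ∨ x = v := by
  constructor
  · rintro ⟨ρ, hρ, h0⟩
    rcases updateFree_cases hρ with ⟨hm, τ, hτ, rfl⟩ | ⟨-, hρ⟩
    · refine .inr (by_contra fun hne => ?_)
      have := h.two_le_budget_of_mem_subtree hv hm hne hτ
      simp only [freed] at h0
      omega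
    · exact .inl ⟨ρ, hρ, h0⟩
  · rintro (hx | rfl)
    · obtain ⟨τ, hτ, h0⟩ := id hx
      exact ⟨τ, (h.freeEdge_tree_of_isHead hv hx).trans hτ, h0⟩
    · obtain ⟨σ, τ, he⟩ := h.exists_treeEdge_of_isParent huv
      refine ⟨_, updateFree_of_mem (mem_subtree_self _ _) he.node_child, ?_⟩
      have := he.budget_eq_of_not_isHead hv
      simp only [freed, this, (isHead_iff he.node_parent).1 hu]

theorem treeEdge_freeEdge (h : Inv P α s) (hu : IsHead s.tree u) (huv : IsParent s.tree u v)
    (hv : ¬ IsHead s.tree v) (hpx : TreeEdge P s p σ x τ) (hx : x ∈ subtree s.tree v) :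
    ∃ σ', TreeEdge P (freeEdge P s u v) p σ' x (freed P u v τ) := by
  have hx' : (freeEdge P s u v).tree x = some (freed P u v τ) :=
    updateFree_of_mem hx hpx.node_child
  by_cases hxv : x = v
  · subst hxv
    obtain rfl := hpx.isParent.unique huv
    have hσ : σ.budget = 0 := (isHead_iff hpx.node_parent).1 hu
    refine ⟨σ, (h.freeEdge_tree_of_isHead hv hu).trans hpx.node_parent, hx', hpx.parent_eq,
      hpx.mem_edges, hpx.ne_target, by rw [freed_key, hpx.key_eq],
      .inl ⟨?_, hσ, Set.mem_insert _ _⟩⟩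
    simp only [freed, hpx.budget_eq_of_not_isHead hv, hσ]
  · have hp := hpx.isParent.parent_mem_subtree hx hxv
    have hp' : ¬ IsHead s.tree p := fun hp' => hv (h.isHead_of_mem_subtree hp hp')
    refine ⟨_, updateFree_of_mem hp hpx.node_parent, hx', hpx.parent_eq, hpx.mem_edges,
      hpx.ne_target, by rw [freed_key, freed_key, hpx.key_eq], .inr ?_⟩
    have hσ := (isHead_iff hpx.node_parent).not.1 hp'
    have := hpx.budget_eq_of_not_isHead fun hx' => hp' (hpx.isHead_parent hx')
    simp only [freed]
    omega

theorem exists_treeEdge_freeEdge (h : Inv P α s) (hu : IsHead s.tree u)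
    (huv : IsParent s.tree u v) (hv : ¬ IsHead s.tree v)
    (hx : (freeEdge P s u v).tree x = some ρ) (hs : x ≠ P.source) :
    ∃ p σ, TreeEdge P (freeEdge P s u v) p σ x ρ := by
  rcases updateFree_cases hx with ⟨hm, τ, hτ, rfl⟩ | ⟨hm, hτ⟩ <;>
    obtain ⟨p, σ, hp⟩ := h.exists_treeEdge x _ hτ hs
  · exact ⟨p, h.treeEdge_freeEdge hu huv hv hp hm⟩
  · refine ⟨p, σ, hp.mono ?_ hx hp.mem_edges (Set.subset_insert _ _)⟩
    exact (updateFree_of_not_mem fun hpm => hm (hp.isParent.mem_subtree hpm)).trans hp.node_parent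

theorem freeEdge (h : Inv P α s) (hu : IsHead s.tree u) (huv : IsParent s.tree u v)
    (hv : ¬ IsHead s.tree v) (hshort : IsShortest P s v) (hc : ¬ P.inCollision u v) :
    Inv P α (freeEdge P s u v) := by
  have isHead_iff (x : V) := h.isHead_freeEdge (x := x) hu huv hv
  have isHead_of {x : V} (hx : IsHead s.tree x) := (isHead_iff x).2 (.inl hx)
  constructor
  · exact (h.freeEdge_tree_of_isHead hv h.isHead_source).trans h.root
  · exact fun x ρ hx hs => h.exists_treeEdge_freeEdge hu huv hv hx hs
  · intro x ρ hx
    rcases updateFree_cases hx with ⟨-, τ, hτ, rfl⟩ | ⟨-, hτ⟩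
    · exact (Nat.cast_le.2 (Nat.sub_le _ _)).trans (h.budget_le x τ hτ)
    · exact h.budget_le x ρ hτ
  · intro x y
    simp only [LRAState.freeEdge, Set.mem_insert_iff, h.mem_edges_iff x y]
    by_cases hxy : (x, y) = (u, v)
    · obtain ⟨rfl, rfl⟩ := Prod.ext_iff.1 hxy
      simp [hc]
    · simp [hxy]
  · intro x hx
    rw [isShortest_freeEdge]
    rcases (isHead_iff x).1 hx with hx | rfl
    · exact h.isShortest_of_isHead x hx
    · exact hshort
  · rintro x y (hxy | hxy)
    · cases hxy
      exact isHead_of hu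
    · exact isHead_of (h.isHead_of_mem_evaluated x y hxy)
  · intro x y hxy hxy'
    simp only [LRAState.freeEdge, isParent_updateFree]
    rcases hxy with hxy | hxy
    · cases hxy
      exact ⟨huv, (isHead_iff v).2 (.inr rfl)⟩
    · exact (h.isHead_child x y hxy hxy').imp_right isHead_of
  · intro ht
    rcases (isHead_iff _).1 ht with ht | ht
    · exact (h.finished_or_eq ht).imp_left .inl
    · exact .inl (.inr ht.symm)
  · rintro (hf | rfl)
    · exact isHead_of (h.isHead_of_finished hf)
    · exact (isHead_iff _).2 (.inr rfl)

end Inv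

end LRAState

/-! ### Evaluation of tree paths -/

namespace LRAState

variable {V : Type*} {P : SPProblem V} {α : ℕ∞} {s : LRAState V}
  {T : V → Option (LRANode V)} {u v w x y z : V} {τ : LRANode V} {es : List (V × V)}

/-- `es` lists the edges of a path from `x` to `z` in the tree, none of which belongs to the
evaluated head of the path to `z`. -/
inductive BandPath (T : V → Option (LRANode V)) : V → List (V × V) → V → Prop
  | nil (x : V) : BandPath T x [] x
  | cons {x y z : V} {es : List (V × V)} : IsParent T x y → ¬ IsHead T y → BandPath T y es z →
      BandPath T x ((x, y) :: es) z

namespace BandPath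

theorem concat (h : BandPath T x es y) (hyz : IsParent T y z) (hz : ¬ IsHead T z) :
    BandPath T x (es ++ [(y, z)]) z := by
  induction h with
  | nil x => exact cons hyz hz (nil z)
  | cons hxy hy _ ih => exact cons hxy hy (ih hyz)

theorem mem_subtree (h : BandPath T x es z) : z ∈ subtree T x := by
  induction h with
  | nil x => exact mem_subtree_self T x
  | cons hxy _ _ ih => exact Relation.ReflTransGen.head hxy ih

theorem mem_subtree_of_mem (h : BandPath T x es z) {e : V × V} (he : e ∈ es) :
    z ∈ subtree T e.2 := by
  induction h with
  | nil x => cases he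
  | cons _ _ hes ih =>
    rcases List.mem_cons.1 he with rfl | he
    · exact hes.mem_subtree
    · exact ih he

theorem take (h : BandPath T x es z) (n : ℕ) :
    ∃ y, BandPath T x (es.take n) y ∧ z ∈ subtree T y := by
  induction h generalizing n with
  | nil x => exact ⟨x, by rw [List.take_nil]; exact nil x, mem_subtree_self T x⟩
  | @cons x _ _ _ hxy hy hes ih =>
    cases n with
    | zero => exact ⟨x, nil x, (cons hxy hy hes).mem_subtree⟩
    | succ n =>
      obtain ⟨q, hq, hz⟩ := ih n
      exact ⟨q, cons hxy hy hq, hz⟩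

theorem freeEdge (h : BandPath s.tree x es z) (hx : x ∈ subtree s.tree v) (hs : Inv P α s)
    (hu : IsHead s.tree u) (huv : IsParent s.tree u v) (hv : ¬ IsHead s.tree v) :
    BandPath (freeEdge P s u v).tree x es z := by
  induction h with
  | nil x => exact nil x
  | @cons x y _ _ hxy hy _ ih =>
    refine cons ?_ (fun hy' => ?_) (ih (hxy.mem_subtree hx))
    · rwa [LRAState.freeEdge, isParent_updateFree]
    · obtain rfl := ((hs.isHead_freeEdge hu huv hv).1 hy').resolve_left hy
      obtain ⟨σ, τ, he⟩ := hs.exists_treeEdge_of_isParent hxy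
      obtain ⟨ρ, hρ, hle⟩ := hs.exists_key_le_of_mem_subtree hx he.node_parent
      obtain rfl := Option.some.inj (he.node_child.symm.trans hρ)
      exact hle.not_gt (hs.key_lt_of_treeEdge he)

end BandPath

namespace Inv

theorem exists_bandPath_lastEdges (h : Inv P α s) {k : ℕ} (hv : s.tree v = some τ)
    (hk : k ≤ τ.budget) : ∃ x σ, s.tree x = some σ ∧ σ.budget + k = τ.budget ∧
      BandPath s.tree x (lastEdges s.tree k v) v := by
  induction k generalizing v τ with
  | zero => exact ⟨v, τ, hv, rfl, .nil v⟩
  | succ k ih =>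
    have hv' : ¬ IsHead s.tree v := (isHead_iff hv).not.2 (by omega)
    obtain ⟨p, σ, hp⟩ := h.exists_treeEdge v τ hv fun hs => hv' (hs ▸ h.isHead_source)
    have hb := hp.budget_eq_of_not_isHead hv'
    obtain ⟨x, ρ, hρ, hρb, hpath⟩ := ih hp.node_parent (by omega)
    refine ⟨x, ρ, hρ, by omega, ?_⟩
    simpa only [lastEdges, hv, Option.bind_some, hp.parent_eq] using hpath.concat hp.isParent hv'

theorem exists_bandPath_tail (h : Inv P α s) (hv : s.tree v = some τ) :
    ∃ x, IsHead s.tree x ∧ BandPath s.tree x (tail s.tree v) v := by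
  obtain ⟨x, σ, hσ, hb, hpath⟩ := h.exists_bandPath_lastEdges hv le_rfl
  exact ⟨x, ⟨σ, hσ, by omega⟩, by simpa only [tail, hv] using hpath⟩

theorem not_mem_evaluated (h : Inv P α s) (huv : IsParent s.tree u v)
    (hv : ¬ IsHead s.tree v) : (u, v) ∉ s.evaluated := by
  intro hev
  obtain ⟨σ, τ, he⟩ := h.exists_treeEdge_of_isParent huv
  by_cases hc : P.inCollision u v
  · exact ((h.mem_edges_iff u v).1 he.mem_edges).2 ⟨hev, hc⟩
  · exact hv (h.isHead_child u v hev hc).2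

theorem evaluateEdges (h : Inv P α s) (hes : BandPath s.tree x es z) (hx : IsHead s.tree x)
    (hz : IsShortest P s z) : Inv P α (evaluateEdges P s es) := by
  induction es generalizing s x with
  | nil => exact h
  | cons e es ih =>
    cases hes with
    | cons hxy hy hes =>
      rw [evaluateEdges_cons]
      split_ifs with hc ht
      · exact h.collide hx hy hc
      all_goals have h' := h.freeEdge hx hxy hy (h.isShortest_of_mem_subtree hes.mem_subtree hz) hc
      · exact h'
      · exact ih h' (hes.freeEdge (mem_subtree_self _ _) h hx hxy hy)
          ((h.isHead_freeEdge hx hxy hy).2 (.inr rfl)) (isShortest_freeEdge.2 hz)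

end Inv

theorem subset_evaluateEdges (P : SPProblem V) (s : LRAState V) (es : List (V × V)) :
    s.evaluated ⊆ (evaluateEdges P s es).evaluated := by
  induction es generalizing s with
  | nil => exact subset_rfl
  | cons e es ih =>
    rw [evaluateEdges_cons]
    split_ifs
    · exact Set.subset_insert _ _
    · exact Set.subset_insert _ _
    · exact fun e' he' => ih _ (Set.mem_insert_of_mem _ he')

theorem mem_evaluateEdges_cons (P : SPProblem V) (s : LRAState V) (e : V × V)
    (es : List (V × V)) : e ∈ (evaluateEdges P s (e :: es)).evaluated := by
  rw [evaluateEdges_cons]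
  split_ifs
  · exact Set.mem_insert _ _
  · exact Set.mem_insert _ _
  · exact subset_evaluateEdges P _ _ (Set.mem_insert _ _)

theorem evaluateEdges_singleton (P : SPProblem V) (s : LRAState V) (e : V × V) :
    (evaluateEdges P s [e]).evaluated = insert e s.evaluated := by
  rw [evaluateEdges_cons]
  split_ifs <;> rfl

theorem edges_evaluateEdges_of_finished (hs : ¬ s.finished)
    (h : (evaluateEdges P s es).finished) :
    (evaluateEdges P s es).edges = s.edges ∧ ∃ e ∈ es, e.2 = P.target := by
  induction es generalizing s with
  | nil => exact absurd h hs
  | cons e es ih =>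
    rw [evaluateEdges_cons] at h ⊢
    split_ifs at h ⊢ with hc ht
    · exact absurd h hs
    · exact ⟨rfl, e, List.mem_cons_self, ht⟩
    · obtain ⟨hedges, e', he', ht'⟩ := ih (by rintro (hf | hv); exacts [hs hf, ht hv]) h
      exact ⟨hedges, e', List.mem_cons_of_mem _ he', ht'⟩

theorem takeFirst_one_cons {A : Type*} (a : A) (l : List A) : takeFirst 1 (a :: l) = [a] := by
  have h : min (1 : ℕ∞) ((a :: l).length : ℕ∞) = 1 :=
    min_eq_left (Nat.one_le_cast.2 (Nat.succ_pos _))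
  rw [takeFirst, h, ENat.toNat_one, List.take_succ_cons, List.take_zero]

theorem exists_takeFirst_cons {A : Type*} {β : ℕ∞} (hβ : 1 ≤ β) (a : A) (l : List A) :
    ∃ m, takeFirst β (a :: l) = a :: m := by
  have hlen : min β ((a :: l).length : ℕ∞) ≠ ⊤ :=
    ne_top_of_le_ne_top (ENat.natCast_ne_top _) (min_le_right _ _)
  have hpos : 1 ≤ (min β ((a :: l).length : ℕ∞)).toNat := by
    rw [← Nat.one_le_cast (α := ℕ∞), ENat.natCast_toNat hlen]
    exact le_min hβ (Nat.one_le_cast.2 (Nat.succ_pos _))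
  obtain ⟨n, hn⟩ := Nat.exists_eq_add_of_le' hpos
  exact ⟨l.take n, by rw [takeFirst, hn, List.take_succ_cons]⟩

/-- The search tree is fully extended. -/
def IsExtended (P : SPProblem V) (α : ℕ∞) (s : LRAState V) : Prop :=
  ∀ p τ v, ¬ Offers P α s p τ v

namespace Inv

theorem exists_key_le (h : Inv P α s) (hext : IsExtended P α s) {c : ℝ}
    (hc : c ∈ P.walkCosts s.edges v) : (∃ τ, s.tree v = some τ ∧ τ.key ≤ c) ∨
      ∃ w τ, InFrontier P α s w τ ∧ τ.key ≤ c := by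
  induction hc with
  | source => exact .inl ⟨_, h.root, (add_zero (0 : ℝ)).le⟩
  | @step p v c _ he ih =>
    have hpos := h.lazyCost_pos he
    rcases ih with ⟨τ, hτ, hk⟩ | ⟨w, τ, hw, hk⟩
    · by_cases hfr : InFrontier P α s p τ
      · exact .inr ⟨p, τ, hfr, by linarith⟩
      · simp only [InFrontier, hτ, true_and, not_or] at hfr
        have hno := hext p τ v
        simp only [Offers, hτ, true_and, he, not_and, not_forall, child_key, not_lt] at hno
        obtain ⟨σ, hσ, hle⟩ := hno hfr.2 (lt_of_le_of_ne (h.budget_le p τ hτ) hfr.1)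
        exact .inl ⟨σ, hσ, by linarith⟩
    · exact .inr ⟨w, τ, hw, by linarith⟩

theorem exists_frontier_of_mem_walkCosts_target (h : Inv P α s) (hext : IsExtended P α s) {c : ℝ}
    (hc : c ∈ P.walkCosts s.edges P.target) : ∃ w τ, InFrontier P α s w τ ∧ τ.key ≤ c := by
  obtain ⟨τ, hτ, hk⟩ | hw := h.exists_key_le hext hc
  · exact ⟨_, τ, ⟨hτ, .inr rfl⟩, hk⟩
  · exact hw

theorem isShortest_of_isMinFrontier (h : Inv P α s) (hext : IsExtended P α s)
    (hv : IsMinFrontier P α s v) : IsShortest P s v := by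
  obtain ⟨τ, ⟨hτ, -⟩, hmin⟩ := hv
  intro τ' hτ' c hc
  obtain rfl : τ = τ' := Option.some.inj (hτ.symm.trans hτ')
  obtain ⟨σ, hσ, hk⟩ | ⟨w, σ, hw, hk⟩ := h.exists_key_le hext hc
  · exact (Option.some.inj (hτ.symm.trans hσ)) ▸ hk
  · exact (hmin w σ hw).trans hk

end Inv

end LRAState

/-! ### Elementary steps and termination -/

namespace LRAState

variable {V : Type*} {P : SPProblem V} {α β : ℕ∞} {s s' : LRAState V}
  {p v w : V} {τ : LRANode V} {e : V × V} {S : Set V}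

theorem exists_bestOffer [Finite V] (hv : v ∈ S) (ho : Offers P α s p τ v) :
    ∃ o, BestOffer P α s S o := by
  let O : Set (V × LRANode V × V) := {o | o.2.2 ∈ S ∧ Offers P α s o.1 o.2.1 o.2.2}
  have hO : O.Finite := by
    refine Set.Finite.of_finite_image (f := fun o => (o.1, o.2.2)) (Set.toFinite _) ?_
    rintro ⟨p, τ, v⟩ h ⟨q, σ, x⟩ h' heq
    obtain ⟨rfl, rfl⟩ := Prod.ext_iff.1 heq
    exact congrArg (fun ρ => (p, ρ, v)) (Option.some.inj (h.2.1.symm.trans h'.2.1))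
  obtain ⟨o, ho, hmin⟩ := Set.exists_min_image O (fun o => (child P o.2.1 o.1 o.2.2).key) hO
    ⟨(p, τ, v), hv, ho⟩
  exact ⟨o, ho.1, ho.2, fun q σ x hx hq => hmin (q, σ, x) ⟨hx, hq⟩⟩

theorem exists_isMinFrontier [Finite V] (h : InFrontier P α s v τ) :
    ∃ w, IsMinFrontier P α s w := by
  have key_eq {x ρ} (hρ : InFrontier P α s x ρ) : (s.tree x).elim 0 LRANode.key = ρ.key := by
    rw [hρ.1, Option.elim]
  obtain ⟨w, ⟨σ, hσ⟩, hmin⟩ := Set.exists_min_image {v | ∃ τ, InFrontier P α s v τ}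
    (fun x => (s.tree x).elim 0 LRANode.key) (Set.toFinite _) ⟨v, τ, h⟩
  exact ⟨w, σ, hσ, fun x ρ hρ => key_eq hσ ▸ key_eq hρ ▸ hmin x ⟨ρ, hρ⟩⟩

/-- `s'` arises from `s` by one of the elementary steps of LRA*, the choices of the step being
arbitrary best offers and frontier nodes of minimal key. -/
inductive Transition (P : SPProblem V) (α β : ℕ∞) (s : LRAState V) : LRAState V → Prop
  | returned (hf : s.finished) : Transition P α β s s
  | rewire {o : V × LRANode V × V} (hf : ¬ s.finished) (ho : BestOffer P α s s.pending o) :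
      Transition P α β s (attach P s o)
  | clear (hf : ¬ s.finished) (hp : s.pending.Nonempty) :
      Transition P α β s { s with pending := ∅ }
  | extend {o : V × LRANode V × V} (hf : ¬ s.finished) (hp : s.pending = ∅)
      (ho : BestOffer P α s Set.univ o) : Transition P α β s (attach P s o)
  | evaluate {w : V} (hf : ¬ s.finished) (hext : IsExtended P α s)
      (hw : IsMinFrontier P α s w) :
      Transition P α β s (evaluateEdges P s (takeFirst β (tail s.tree w)))
  | fail (hf : ¬ s.finished) (hext : IsExtended P α s) (hno : ∀ w τ, ¬ InFrontier P α s w τ) :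
      Transition P α β s s

theorem transition_step [Finite V] (P : SPProblem V) (α β : ℕ∞) (s : LRAState V) :
    Transition P α β s (step P α β s) := by
  unfold step
  split_ifs with hf h₁ h₂ h₃ h₄
  · exact .returned hf
  · exact .rewire hf h₁.choose_spec
  · exact .clear hf h₂
  · exact .extend hf (Set.not_nonempty_iff_eq_empty.1 h₂) h₃.choose_spec
  all_goals have hext : IsExtended P α s :=
    fun p τ v ho => h₃ (exists_bestOffer (Set.mem_univ v) ho)
  · exact .evaluate hf hext h₄.choose_spec
  · exact .fail hf hext fun w τ hw => h₄ (exists_isMinFrontier hw)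

namespace Inv

theorem exists_bandPath_takeFirst (β : ℕ∞) (h : Inv P α s) (hv : s.tree v = some τ) :
    ∃ x y, IsHead s.tree x ∧ BandPath s.tree x (takeFirst β (tail s.tree v)) y ∧
      v ∈ subtree s.tree y := by
  obtain ⟨x, hx, hpath⟩ := h.exists_bandPath_tail hv
  obtain ⟨y, hy, hv⟩ := hpath.take _
  exact ⟨x, y, hx, hy, hv⟩

theorem transition [Finite V] (h : Inv P α s) (hs : Transition P α β s s') : Inv P α s' := by
  cases hs with
  | returned | fail => exact h
  | rewire _ ho | extend _ _ ho => exact h.attach ho.2.1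
  | clear =>
    exact h.replaceTree ∅ (fun _ _ _ => Iff.rfl)
      (fun v τ hv hne => (h.exists_treeEdge v τ hv hne).imp fun p => Exists.imp fun σ hp =>
        hp.mono hp.node_parent hv hp.mem_edges subset_rfl) h.budget_le
  | evaluate _ hext hw =>
    obtain ⟨τ, ⟨hτ, -⟩, -⟩ := id hw
    obtain ⟨x, y, hx, hpath, hy⟩ := h.exists_bandPath_takeFirst β hτ
    exact h.evaluateEdges hpath hx
      (h.isShortest_of_mem_subtree hy (h.isShortest_of_isMinFrontier hext hw))

theorem iterate_step [Finite V] (h : Inv P α s) (β : ℕ∞) (k : ℕ) :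
    Inv P α ((step P α β)^[k] s) := by
  induction k with
  | zero => exact h
  | succ k ih =>
    rw [Function.iterate_succ_apply']
    exact ih.transition (transition_step P α β _)

end Inv

namespace Transition

theorem evaluated_subset (hs : Transition P α β s s') : s.evaluated ⊆ s'.evaluated := by
  cases hs with
  | evaluate => exact subset_evaluateEdges ..
  | _ => exact subset_rfl

theorem mem_evaluated_one [Finite V] (hs : Transition P α 1 s s') (he : e ∈ s'.evaluated) :
    e ∈ s.evaluated ∨ IsExtended P α s ∧ ∃ w es, IsMinFrontier P α s w ∧
      tail s.tree w = e :: es := by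
  cases hs with
  | @evaluate w _ hext hw =>
    cases htail : tail s.tree w with
    | nil =>
      rw [htail, takeFirst, List.take_nil] at he
      exact .inl he
    | cons e' es =>
      rw [htail, takeFirst_one_cons, evaluateEdges_singleton] at he
      rcases he with rfl | he
      · exact .inr ⟨hext, w, es, hw, htail⟩
      · exact .inl he
  | _ => exact .inl he

end Transition

theorem evaluated_iterate_step_mono [Finite V] (P : SPProblem V) (α β : ℕ∞) (s : LRAState V) :
    Monotone fun k => ((step P α β)^[k] s).evaluated := by
  refine monotone_nat_of_le_succ fun k => ?_
  rw [Function.iterate_succ_apply']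
  exact (transition_step P α β _).evaluated_subset

/-- The vertices whose nodes are final within an extension phase, because no offer has a smaller
key. An extension phase ends since each of its steps settles a further vertex. -/
def settled (P : SPProblem V) (α : ℕ∞) (s : LRAState V) : Set V :=
  {v | ∃ σ, s.tree v = some σ ∧ ∀ p τ x, Offers P α s p τ x → σ.key ≤ (child P τ p x).key}

namespace Inv

theorem child_key_le_of_offers_attach {q x : V} {σ : LRANode V} (h : Inv P α s)
    (hbest : BestOffer P α s Set.univ (p, τ, v))
    (ho : Offers P α (LRAState.attach P s (p, τ, v)) q σ x) :
    (child P τ p v).key ≤ (child P σ q x).key := by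
  obtain ⟨-, hpv, hmin⟩ := hbest
  obtain ⟨hq, hqt, hb, he, hk⟩ := ho
  rcases attach_tree_cases hq with ⟨rfl, rfl⟩ | ⟨-, hq⟩
  · rw [child_key _ (child P τ p q)]
    linarith [h.lazyCost_pos he]
  by_contra! hlt
  refine hlt.not_ge (hmin q σ x (Set.mem_univ x) ⟨hq, hqt, hb, he, fun ρ hρ => ?_⟩)
  by_cases hx : x ∈ subtree s.tree v
  · exact hlt.trans (hpv.child_key_lt_of_mem_subtree h hx hρ)
  · exact hk ρ ((attach_tree_of_not_mem P p τ hx).trans hρ)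

theorem settled_ssubset_attach (h : Inv P α s) (hbest : BestOffer P α s Set.univ (p, τ, v)) :
    settled P α s ⊂ settled P α (LRAState.attach P s (p, τ, v)) := by
  have ho : Offers P α s p τ v := hbest.2.1
  have not_mem_subtree {x} (hx : x ∈ settled P α s) : x ∉ subtree s.tree v := by
    obtain ⟨σ, hσ, hle⟩ := hx
    exact fun hm => (ho.child_key_lt_of_mem_subtree h hm hσ).not_ge (hle p τ v ho)
  refine (Set.ssubset_iff_of_subset ?_).2
    ⟨v, ?_, fun hv => not_mem_subtree hv (mem_subtree_self _ _)⟩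
  · intro x hx
    obtain ⟨σ, hσ, hle⟩ := id hx
    exact ⟨σ, (attach_tree_of_not_mem P p τ (not_mem_subtree hx)).trans hσ, fun _ _ _ hq =>
      (hle p τ v ho).trans (h.child_key_le_of_offers_attach hbest hq)⟩
  · exact ⟨_, attach_tree_self P s p v τ, fun _ _ _ => h.child_key_le_of_offers_attach hbest⟩

theorem ne_target_of_ne_source [Finite V] (h : Inv P α s) (hv : s.tree v = some τ)
    (hne : v ≠ P.source) : P.source ≠ P.target := by
  refine h.tree_induction (motive := fun v _ => v ≠ P.source → P.source ≠ P.target)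
    (fun h => absurd rfl h) (fun p σ v τ hp ih _ => ?_) hv hne
  by_cases hps : p = P.source
  · exact hps ▸ hp.ne_target
  · exact ih hps

theorem nontrivial_of_tail_eq_cons [Finite V] {es : List (V × V)} (h : Inv P α s)
    (hw : s.tree w = some τ) (htail : tail s.tree w = e :: es) :
    α ≠ 0 ∧ P.source ≠ P.target := by
  obtain ⟨x, -, hpath⟩ := h.exists_bandPath_tail hw
  rw [htail] at hpath
  cases hpath with
  | cons hxy hy _ =>
    obtain ⟨ρ, hρ, -⟩ := id hxy
    refine ⟨?_, h.ne_target_of_ne_source hρ (h.ne_source_of_isParent hxy)⟩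
    rintro rfl
    exact hy ((isHead_iff hρ).2 (by simpa using h.budget_le _ ρ hρ))

theorem exists_tail_eq_cons (h : Inv P α s) (hf : ¬ s.finished) (hα : α ≠ 0)
    (hst : P.source ≠ P.target) (hw : InFrontier P α s w τ) :
    ∃ e es, tail s.tree w = e :: es ∧ e ∉ s.evaluated := by
  obtain ⟨x, hx, hpath⟩ := h.exists_bandPath_tail hw.1
  cases htail : tail s.tree w with
  | nil =>
    rw [htail] at hpath
    cases hpath
    rcases hw.2 with hb | rfl
    · rw [(isHead_iff hw.1).1 hx] at hb
      exact absurd hb.symm hα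
    · exact absurd (h.finished_or_eq hx) (not_or_intro hf hst.symm)
  | cons e es =>
    rw [htail] at hpath
    cases hpath with
    | cons hxy hy _ => exact ⟨_, es, rfl, h.not_mem_evaluated hxy hy⟩

theorem evaluated_ssubset_evaluateEdges [Finite V] (h : Inv P α s) (hf : ¬ s.finished) (hα : α ≠ 0)
    (hβ : 1 ≤ β) (hst : P.source ≠ P.target) (hw : InFrontier P α s w τ) :
    s.evaluated ⊂
      (LRAState.evaluateEdges P s (takeFirst β (tail s.tree w))).evaluated := by
  obtain ⟨e, es, htail, he⟩ := h.exists_tail_eq_cons hf hα hst hw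
  refine (Set.ssubset_iff_of_subset (subset_evaluateEdges ..)).2 ⟨e, ?_, he⟩
  obtain ⟨m, hm⟩ := exists_takeFirst_cons hβ e es
  rw [htail, hm]
  exact mem_evaluateEdges_cons P s e m

end Inv

/-- The termination measure of LRA*: evaluations decrease its first component, rewiring decreases
the second one, and extensions decrease the third one. -/
noncomputable def potential (P : SPProblem V) (α : ℕ∞) (s : LRAState V) : ℕ ×ₗ ℕ ×ₗ ℕ :=
  toLex (s.evaluatedᶜ.ncard, toLex (s.pending.ncard, (settled P α s)ᶜ.ncard))

theorem potential_lt_of_pending [Finite V] (he : s'.evaluated = s.evaluated)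
    (hp : s'.pending ⊂ s.pending) : potential P α s' < potential P α s :=
  Prod.Lex.toLex_lt_toLex.2 (.inr ⟨by rw [he],
    Prod.Lex.toLex_lt_toLex.2 (.inl (Set.ncard_lt_ncard hp))⟩)

/-- `f` is a state in which a run has come to its end and `g` is the last fully extended state of
this run. If the run fails, then `f = g` and there is no frontier node. -/
structure IsOutcome (P : SPProblem V) (α : ℕ∞) (g f : LRAState V) : Prop where
  inv_last : Inv P α g
  inv : Inv P α f
  isExtended : IsExtended P α g
  edges_eq : g.edges = f.edges
  evaluated_subset : g.evaluated ⊆ f.evaluated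
  target_of_inFrontier : ∀ w ρ, InFrontier P α g w ρ →
    ∃ τ, f.tree P.target = some τ ∧ τ.budget = 0 ∧ τ.key ≤ ρ.key

theorem Transition.isOutcome_of_finished [Finite V] (hs : Transition P α β s s') (h : Inv P α s)
    (hf : ¬ s.finished) (hfin : s'.finished) : IsOutcome P α s s' := by
  have h' := h.transition hs
  cases hs with
  | returned | rewire | clear | extend | fail => exact absurd hfin hf
  | evaluate _ hext hw =>
    obtain ⟨hedges, e, he, ht⟩ := edges_evaluateEdges_of_finished hf hfin
    obtain ⟨τ, ⟨hτ, -⟩, hmin⟩ := hw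
    refine ⟨h, h', hext, hedges.symm, subset_evaluateEdges .., fun v ρ hv => ?_⟩
    obtain ⟨x, y, -, hpath, hy⟩ := h.exists_bandPath_takeFirst β hτ
    obtain ⟨π, hπ, hle⟩ := h.exists_key_le_of_mem_subtree
      (ht ▸ (hpath.mem_subtree_of_mem he).trans hy) hτ
    obtain ⟨σ, hσ, h0⟩ := h'.isHead_of_finished hfin
    have hσπ : σ.key ≤ π.key :=
      h'.isShortest_of_isHead _ ⟨σ, hσ, h0⟩ σ hσ (hedges ▸ h.key_mem_walkCosts hπ)
    exact ⟨σ, hσ, h0, hσπ.trans (hle.trans (hmin v ρ hv))⟩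

theorem Transition.isOutcome_or_potential_lt [Finite V] (hs : Transition P α β s s') (h : Inv P α s)
    (hf : ¬ s.finished) (hα : α ≠ 0) (hβ : 1 ≤ β) (hst : P.source ≠ P.target) :
    (s' = s ∧ IsOutcome P α s s) ∨ potential P α s' < potential P α s := by
  cases hs with
  | returned hfin => exact absurd hfin hf
  | fail _ hext hno =>
    exact .inl ⟨rfl, h, h, hext, rfl, subset_rfl, fun w ρ hw => absurd hw (hno w ρ)⟩
  | rewire _ ho =>
    exact .inr (potential_lt_of_pending rfl
      ((Set.ssubset_iff_of_subset Set.sdiff_subset).2 ⟨_, ho.1, fun hm => hm.2 rfl⟩))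
  | clear _ hp => exact .inr (potential_lt_of_pending rfl hp.empty_ssubset)
  | @extend o _ hp ho =>
    refine .inr (Prod.Lex.toLex_lt_toLex.2 (.inr ⟨rfl, Prod.Lex.toLex_lt_toLex.2 (.inr ⟨?_, ?_⟩)⟩))
    · change (s.pending \ {o.2.2}).ncard = s.pending.ncard
      rw [hp, Set.empty_sdiff]
    · exact Set.ncard_lt_ncard (compl_lt_compl_iff_lt.2 (h.settled_ssubset_attach ho))
  | evaluate _ _ hw =>
    obtain ⟨τ, hw, -⟩ := hw
    exact .inr (Prod.Lex.toLex_lt_toLex.2 (.inl (Set.ncard_lt_ncard (compl_lt_compl_iff_lt.2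
      (h.evaluated_ssubset_evaluateEdges hf hα hβ hst hw)))))

theorem Inv.exists_isOutcome [Finite V] (h : Inv P α s) (hf : ¬ s.finished) (hα : α ≠ 0)
    (hβ : 1 ≤ β) (hst : P.source ≠ P.target) : ∃ k g, IsOutcome P α g ((step P α β)^[k] s) ∧
      Function.IsFixedPt (step P α β) ((step P α β)^[k] s) := by
  induction hn : potential P α s using WellFoundedLT.induction generalizing s with
  | _ n ih =>
    have hs := transition_step P α β s
    by_cases hfin : (step P α β s).finished
    · exact ⟨1, s, hs.isOutcome_of_finished h hf hfin, if_pos hfin⟩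
    rcases hs.isOutcome_or_potential_lt h hf hα hβ hst with ⟨heq, hout⟩ | hlt
    · exact ⟨0, s, hout, heq⟩
    · obtain ⟨k, hk⟩ := ih _ (hn ▸ hlt) (h.transition hs) hfin rfl
      exact ⟨k + 1, hk⟩

theorem exists_isOutcome_evaluated_eq [Finite V] (P : SPProblem V) (hα : α ≠ 0) (hβ : 1 ≤ β)
    (hst : P.source ≠ P.target) :
    ∃ g f, IsOutcome P α g f ∧ f.evaluated = LRAEvaluatedEdges P α β := by
  obtain ⟨k, g, hout, hfix⟩ := (Inv.init P α).exists_isOutcome id hα hβ hst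
  refine ⟨g, _, hout, Set.Subset.antisymm (fun e he => ⟨k, he⟩) ?_⟩
  rintro e ⟨m, hm⟩
  have he := evaluated_iterate_step_mono P α β (init P) (Nat.le_add_right m k) hm
  simpa only [Function.iterate_add_apply, (hfix.iterate m).eq] using he

end LRAState

/-! ### Comparison of the two runs -/

namespace LRAState

variable {V : Type*} {P : SPProblem V} {α : ℕ∞} {s f g : LRAState V}
  {u v w x y z : V} {σ τ ρ : LRANode V} {b : ℕ} {c : ℝ}

namespace Inv

theorem edges_anti (hs : Inv P α s) (hf : Inv P α f) (hsf : s.evaluated ⊆ f.evaluated) :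
    f.edges ⊆ s.edges := by
  rintro ⟨x, y⟩ he
  rw [hf.mem_edges_iff] at he
  exact (hs.mem_edges_iff x y).2 ⟨he.1, fun h => he.2 ⟨hsf h.1, h.2⟩⟩

theorem key_mem_walkCosts_of_isHead [Finite V] (hs : Inv P α s) (hf : Inv P α f)
    (hv : s.tree v = some τ) (h0 : IsHead s.tree v) :
    τ.key ∈ P.walkCosts f.edges v := by
  refine hs.tree_induction
    (motive := fun v τ => IsHead s.tree v → τ.key ∈ P.walkCosts f.edges v) ?_ ?_ hv h0
  · exact fun _ => hf.key_mem_walkCosts hf.root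
  · intro p σ v τ hp ih h0
    have hev : (p, v) ∈ s.evaluated := by
      rw [isHead_iff hp.node_child] at h0
      exact (hp.budget.resolve_right (by omega)).2.2
    obtain ⟨hadj, hfree⟩ := (hs.mem_edges_iff p v).1 hp.mem_edges
    rw [hp.key_eq]
    exact SPProblem.add_mem_walkCosts (ih (hp.isHead_parent h0))
      ((hf.mem_edges_iff p v).2 ⟨hadj, fun h => hfree ⟨hev, h.2⟩⟩)

theorem parent_eq_of_key_le [Finite V] (hg : Inv P α g) (hP : P.NoTies)
    (hp : TreeEdge P g z ρ y τ) (hx : c ∈ P.walkCosts g.edges x) (he : (x, y) ∈ g.edges)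
    (hmin : c + P.lazyCost x y ∈ lowerBounds (P.walkCosts g.edges y))
    (hle : τ.key ≤ c + P.lazyCost x y) : x = z ∧ τ.key = c + P.lazyCost x y := by
  have heq := hle.antisymm (hmin (hg.key_mem_walkCosts hp.node_child))
  exact ⟨hP.predecessor_unique hg.edges_subset hx (hg.key_mem_walkCosts hp.node_parent) he
    hp.mem_edges hmin (heq.symm.trans hp.key_eq), heq⟩

end Inv

/-- The search tree of `g` contains a path of cost `c` to `x` with at least `b` edges in its tail,
or a frontier node whose key is at most `c`. The second case arises where the tree of `g` has been
cut off by the lookahead before `x`. -/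
def Covers (P : SPProblem V) (α : ℕ∞) (g : LRAState V) (x : V) (c : ℝ) (b : ℕ) : Prop :=
  (∃ ρ, g.tree x = some ρ ∧ ρ.key = c ∧ b ≤ ρ.budget) ∨
    ∃ w ρ, InFrontier P α g w ρ ∧ ρ.key ≤ c

namespace Covers

theorem of_mem_lowerBounds [Finite V] (hg : Inv P α g) (hext : IsExtended P α g)
    (hc : c ∈ P.walkCosts g.edges x) (hmin : c ∈ lowerBounds (P.walkCosts g.edges x)) :
    Covers P α g x c 0 :=
  (hg.exists_key_le hext hc).imp_left fun ⟨ρ, hρ, hle⟩ =>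
    ⟨ρ, hρ, hle.antisymm (hmin (hg.key_mem_walkCosts hρ)), Nat.zero_le _⟩

theorem step [Finite V] (h : Covers P α g x c b) (hg : Inv P α g) (hext : IsExtended P α g)
    (hP : P.NoTies) (hx : c ∈ P.walkCosts g.edges x) (he : (x, y) ∈ g.edges) (hys : y ≠ P.source)
    (hxy : (x, y) ∉ g.evaluated)
    (hmin : c + P.lazyCost x y ∈ lowerBounds (P.walkCosts g.edges y)) :
    Covers P α g y (c + P.lazyCost x y) (b + 1) := by
  rcases h with ⟨ρ, hρ, -, hb⟩ | ⟨w, ρ, hw, hk⟩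
  · refine (hg.exists_key_le hext (SPProblem.add_mem_walkCosts hx he)).imp_left ?_
    rintro ⟨τ, hτ, hle⟩
    obtain ⟨q, π, hq⟩ := hg.exists_treeEdge y τ hτ hys
    obtain ⟨rfl, heq⟩ := hg.parent_eq_of_key_le hP hq hx he hmin hle
    obtain rfl : π = ρ := Option.some.inj (hq.node_parent.symm.trans hρ)
    have hbudget : τ.budget = π.budget + 1 := hq.budget.resolve_left fun h => hxy h.2.2
    exact ⟨τ, hτ, heq, by omega⟩
  · exact .inr ⟨w, ρ, hw, by linarith [hg.lazyCost_pos he]⟩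

theorem exists_inFrontier (h : Covers P α g w τ.key τ.budget) (hg : Inv P α g)
    (hw : InFrontier P α s w τ) : ∃ z ρ, InFrontier P α g z ρ ∧ ρ.key ≤ τ.key := by
  rcases h with ⟨ρ, hρ, hk, hb⟩ | h
  · refine ⟨w, ρ, ⟨hρ, hw.2.imp_left fun hα => ?_⟩, hk.le⟩
    exact (hg.budget_le w ρ hρ).antisymm (hα ▸ Nat.cast_le.2 hb)
  · exact h

end Covers

/-- The path to `y` with node `τ` is still a path of the current graph of `f`, but it is not
evaluated in `f`, although the tree of `g` covers it. -/
structure IsMissed (P : SPProblem V) (α : ℕ∞) (g f : LRAState V) (y : V) (τ : LRANode V) :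
    Prop where
  key_mem : τ.key ∈ P.walkCosts g.edges y
  not_isHead : ¬ IsHead f.tree y
  covers : Covers P α g y τ.key τ.budget

namespace IsOutcome

theorem edges_subset (h : IsOutcome P α g f) (hs : Inv P α s) (hsf : s.evaluated ⊆ f.evaluated) :
    g.edges ⊆ s.edges :=
  h.edges_eq ▸ hs.edges_anti h.inv hsf

theorem isMissed_of_treeEdge [Finite V] (h : IsOutcome P α g f) (hP : P.NoTies) (hs : Inv P α s)
    (hsf : s.evaluated ⊆ f.evaluated) (hxy : TreeEdge P s x σ y τ) (hy : IsShortest P s y)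
    (hnot : (x, y) ∉ f.evaluated) (hx : σ.key ∈ P.walkCosts g.edges x)
    (hc : Covers P α g x σ.key σ.budget) : IsMissed P α g f y τ := by
  have hys := hs.ne_source_of_isParent hxy.isParent
  have he : (x, y) ∈ g.edges := h.edges_eq ▸ (h.inv.mem_edges_iff x y).2
    ⟨hs.edges_subset hxy.mem_edges, fun h' => hnot h'.1⟩
  have hmem := hxy.key_eq ▸ SPProblem.add_mem_walkCosts hx he
  have hmin : τ.key ∈ lowerBounds (P.walkCosts g.edges y) :=
    lowerBounds_mono_set (SPProblem.walkCosts_mono (h.edges_subset hs hsf) y)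
      (hy τ hxy.node_child)
  have hbudget : τ.budget = σ.budget + 1 := hxy.budget.resolve_left fun h' => hnot (hsf h'.2.2)
  refine ⟨hmem, ?_, ?_⟩
  · rintro ⟨ρ, hρ, h0⟩
    obtain ⟨q, π, hq⟩ := h.inv.exists_treeEdge y ρ hρ hys
    rw [h.edges_eq] at hmem hmin he hx
    have hle := h.inv.isShortest_of_isHead y ⟨ρ, hρ, h0⟩ ρ hρ hmem
    rw [hxy.key_eq] at hmin hle
    obtain ⟨rfl, -⟩ := h.inv.parent_eq_of_key_le hP hq hx he hmin hle
    exact hnot (hq.budget.resolve_right (by omega)).2.2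
  · rw [hbudget, hxy.key_eq]
    exact hc.step h.inv_last h.isExtended hP hx he hys
      (fun h' => hnot (h.evaluated_subset h')) (hxy.key_eq ▸ hmin)

theorem isMissed_of_isHead [Finite V] (h : IsOutcome P α g f) (hP : P.NoTies) (hs : Inv P α s)
    (hsf : s.evaluated ⊆ f.evaluated) (huv : TreeEdge P s u σ v τ) (hu : IsHead s.tree u)
    (hv : IsShortest P s v) (hnot : (u, v) ∉ f.evaluated) : IsMissed P α g f v τ := by
  have hkey : σ.key ∈ P.walkCosts g.edges u :=
    h.edges_eq ▸ hs.key_mem_walkCosts_of_isHead h.inv huv.node_parent hu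
  have hmin : σ.key ∈ lowerBounds (P.walkCosts g.edges u) :=
    lowerBounds_mono_set (SPProblem.walkCosts_mono (h.edges_subset hs hsf) u)
      (hs.isShortest_of_isHead u hu σ huv.node_parent)
  refine h.isMissed_of_treeEdge hP hs hsf huv hv hnot hkey ?_
  rw [(isHead_iff huv.node_parent).1 hu]
  exact .of_mem_lowerBounds h.inv_last h.isExtended hkey hmin

theorem isMissed_of_mem_subtree [Finite V] (h : IsOutcome P α g f) (hP : P.NoTies)
    (hs : Inv P α s) (hsf : s.evaluated ⊆ f.evaluated) (hv : s.tree v = some σ)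
    (hmiss : IsShortest P s v → IsMissed P α g f v σ) (hw : w ∈ subtree s.tree v)
    (hshort : IsShortest P s w) (hτ : s.tree w = some τ) : IsMissed P α g f w τ := by
  change Relation.ReflTransGen _ v w at hw
  induction hw generalizing τ with
  | refl => exact Option.some.inj (hv.symm.trans hτ) ▸ hmiss hshort
  | tail _ hpx ih =>
    obtain ⟨π, ρ, hpx⟩ := hs.exists_treeEdge_of_isParent hpx
    obtain rfl : ρ = τ := Option.some.inj (hpx.node_child.symm.trans hτ)
    have hp := ih (hpx.isShortest_parent hshort) hpx.node_parent
    exact h.isMissed_of_treeEdge hP hs hsf hpx hshort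
      (fun hev => hp.not_isHead (h.inv.isHead_of_mem_evaluated _ _ hev)) hp.key_mem hp.covers

theorem not_isMissed_of_isMinFrontier [Finite V] (h : IsOutcome P α g f) (hP : P.NoTies)
    (hs : Inv P α s) (hext : IsExtended P α s) (hsf : s.evaluated ⊆ f.evaluated)
    (hw : IsMinFrontier P α s w) (hτ : s.tree w = some τ) : ¬ IsMissed P α g f w τ := by
  intro hmiss
  have hshort := hs.isShortest_of_isMinFrontier hext hw τ hτ
  obtain ⟨τ', hw, hmin⟩ := hw
  obtain rfl : τ' = τ := Option.some.inj (hw.1.symm.trans hτ)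
  obtain ⟨z, ρ, hz, hρ⟩ := hmiss.covers.exists_inFrontier h.inv_last hw
  obtain ⟨π, hπ, h0, hπρ⟩ := h.target_of_inFrontier z ρ hz
  have hgs := h.edges_subset hs hsf
  have hmem : π.key ∈ P.walkCosts g.edges P.target :=
    h.edges_eq ▸ h.inv.key_mem_walkCosts hπ
  obtain ⟨y, θ, hy, hθ⟩ := hs.exists_frontier_of_mem_walkCosts_target hext
    (SPProblem.walkCosts_mono hgs _ hmem)
  have heq : π.key = τ'.key := (hπρ.trans hρ).antisymm ((hmin y θ hy).trans hθ)
  have hleast : IsLeast (P.walkCosts g.edges P.target) τ'.key :=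
    ⟨heq ▸ hmem, heq ▸ h.edges_eq ▸ h.inv.isShortest_of_isHead _ ⟨π, hπ, h0⟩ π hπ⟩
  have hleast' : IsLeast (P.walkCosts g.edges w) τ'.key :=
    ⟨hmiss.key_mem, lowerBounds_mono_set (SPProblem.walkCosts_mono hgs w) hshort⟩
  obtain rfl := hP.eq_of_isLeast h.inv_last.edges_subset hleast' hleast
  exact hmiss.not_isHead ⟨π, hπ, h0⟩

theorem mem_evaluated [Finite V] (h : IsOutcome P α g f) (hP : P.NoTies) (hs : Inv P α s)
    (hext : IsExtended P α s) (hsf : s.evaluated ⊆ f.evaluated) (hw : IsMinFrontier P α s w)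
    {e : V × V} {es : List (V × V)} (htail : tail s.tree w = e :: es) : e ∈ f.evaluated := by
  by_contra hnot
  have hshort := hs.isShortest_of_isMinFrontier hext hw
  obtain ⟨τ, ⟨hτ, -⟩, -⟩ := id hw
  obtain ⟨u, hu, hpath⟩ := hs.exists_bandPath_tail hτ
  rw [htail] at hpath
  cases hpath with
  | cons huv _ hes =>
    obtain ⟨σ, ρ, huv⟩ := hs.exists_treeEdge_of_isParent huv
    exact h.not_isMissed_of_isMinFrontier hP hs hext hsf hw hτ
      (h.isMissed_of_mem_subtree hP hs hsf huv.node_child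
        (fun hv => h.isMissed_of_isHead hP hs hsf huv hu hv hnot) hes.mem_subtree hshort hτ)

end IsOutcome

end LRAState

open LRAState in
theorem mainTheorem7_general {V : Type*} [Finite V] (P : SPProblem V) (hP : P.NoTies) (α : ℕ∞)
    {β : ℕ∞} (hβ : 1 ≤ β) : LRAEvaluatedEdges P α 1 ⊆ LRAEvaluatedEdges P α β := by
  rintro e ⟨k, hk⟩
  induction k generalizing e with
  | zero => exact absurd hk (Set.notMem_empty e)
  | succ k ih =>
    rw [Function.iterate_succ_apply'] at hk
    obtain he | ⟨hext, w, es, hw, htail⟩ := (transition_step P α 1 _).mem_evaluated_one hk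
    · exact ih he
    have hs := (Inv.init P α).iterate_step 1 k
    obtain ⟨τ, ⟨hτ, -⟩, -⟩ := id hw
    obtain ⟨hα, hst⟩ := hs.nontrivial_of_tail_eq_cons hτ htail
    obtain ⟨g, f, hout, hf⟩ := exists_isOutcome_evaluated_eq P hα hβ hst
    rw [← hf] at ih ⊢
    exact hout.mem_evaluated hP hs hext (fun _ he => ih he) hw htail

theorem mainTheorem7 {V : Type*} [Finite V] (P : SPProblem V) (hP : P.NoTies)
    (α β : ℕ∞) (hβ : 1 < β) (hβα : β ≤ α) :
    LRAEvaluatedEdges P α 1 ⊆ LRAEvaluatedEdges P α β :=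
  mainTheorem7_general P hP α hβ.le
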